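/- For a finite connected graph $G$ with at least two vertices, let $d_{xy}$ denote the graph distance, let $W_G=\frac12\sum_{x,y\in V(G)}d_{xy}$ be the Wiener index, and let $|G|$ be the number of vertices. For the unbiased discrete-time random walk on $G$ (from a vertex the walker moves to a uniformly chosen neighbour), let $H_{x\to y}$ be the expected first time at which the walk started at $x$ is at $y$ (so $H_{x\to x}=0$), and let $$\langle\mathcal H_G\rangle=\frac{1}{|G|(|G|-1)}\sum_{x,y\in V(G)}H_{x\to y}$$ be the mean hitting time. Let $m\ge 0$ be an integer. The $m$-order T-fractal operation replaces every edge $xy$ of a graph by a path $x\,w\,y$ through a new vertex $w$ and attaches $m$ new leaves to $w$. Let $\mathcal T$ be a finite tree with $n\ge 1$ vertices and, for $t\ge 0$, let $\mathcal T^{\mathrm T}_m(t)$ be the graph obtained from $\mathcal T=\mathcal T^{\mathrm T}_m(0)$ by applying the $m$-order T-fractal operation $t$ times (the generalized T-fractal). Then for all $t\ge 0$ $$|\mathcal T^{\mathrm T}_m(t)|=(n-1)(m+2)^t+1,$$ and, if $n\ge 2$, the mean hitting time of $\mathcal T^{\mathrm T}_m(t)$ is finite and equals $$\langle\mathcal H_{\mathcal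 T^{\mathrm T}_m(t)}\rangle=\frac{2}{|\mathcal T^{\mathrm T}_m(t)|}\Big\{f_4^{\,t}\,W_{\mathcal T}-g_4\sum_{i=0}^{t-1}f_4^{\,i}\,|\mathcal T^{\mathrm T}_m(t-1-i)|^2-h_4\sum_{i=0}^{t-1}f_4^{\,i}\,|\mathcal T^{\mathrm T}_m(t-1-i)|+l_4\sum_{i=0}^{t-1}f_4^{\,i}\Big\},$$ where $f_4=2(m+2)^2$, $g_4=m+2$, $h_4=(m-1)(m+2)$ and $l_4=m^2+2m$. -/

import Mathlib

open MeasureTheory ProbabilityTheory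
open scoped ENNReal

universe u

noncomputable section

/-! ### Wiener index -/

/-- The Wiener index `W_G = (1/2) ∑_{u,v} d(u,v)` of a finite graph. -/
def wienerIndex {V : Type u} [Fintype V] (G : SimpleGraph V) : ℝ :=
  (1 / 2) * ∑ x : V, ∑ y : V, (G.dist x y : ℝ)

/-! ### Simple random walk and hitting times -/

open Classical in
/-- The law of one step of the unbiased random walk from `x`: uniform over the neighbours of `x`.
A walker at an isolated vertex stays there. -/
def walkStep {V : Type u} [Fintype V] (G : SimpleGraph V) (x : V) : PMF V :=
  if h : (G.neighborFinset x).Nonempty then PMF.uniformOfFinset (G.neighborFinset x) h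
  else PMF.pure x

/-- The one-step transition kernel of the random walk. -/
def walkKernel {V : Type u} [Fintype V] [MeasurableSpace V] [DiscreteMeasurableSpace V]
    (G : SimpleGraph V) : Kernel V V where
  toFun x := (walkStep G x).toMeasure
  measurable' := measurable_of_countable _

instance walkKernel_isMarkovKernel {V : Type u} [Fintype V] [MeasurableSpace V]
    [DiscreteMeasurableSpace V] (G : SimpleGraph V) : IsMarkovKernel (walkKernel G) :=
  ⟨fun x => PMF.toMeasure.isProbabilityMeasure (walkStep G x)⟩

/-- The transition from the trajectory up to time `k` to the position at time `k + 1`: it depends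
on the current position only. -/
def walkHistoryKernel {V : Type u} [Fintype V] [MeasurableSpace V] [DiscreteMeasurableSpace V]
    (G : SimpleGraph V) (k : ℕ) : Kernel (Finset.Iic k → V) V :=
  (walkKernel G).comap (fun h => h ⟨k, Finset.mem_Iic.2 le_rfl⟩) (measurable_pi_apply _)

instance walkHistoryKernel_isMarkovKernel {V : Type u} [Fintype V] [MeasurableSpace V]
    [DiscreteMeasurableSpace V] (G : SimpleGraph V) (k : ℕ) :
    IsMarkovKernel (walkHistoryKernel G k) := by
  unfold walkHistoryKernel; infer_instance

/-- The law, on the space of trajectories `ℕ → V`, of the random walk started at `x`. -/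
def walkLaw {V : Type u} [Fintype V] [MeasurableSpace V] [DiscreteMeasurableSpace V]
    (G : SimpleGraph V) (x : V) : Measure (ℕ → V) :=
  Kernel.trajMeasure (X := fun _ => V) (Measure.dirac x) (walkHistoryKernel G)

/-- The first time at which a trajectory is at `y` (infinite if it never is). -/
def firstVisit {V : Type u} (y : V) (ω : ℕ → V) : ℝ≥0∞ :=
  ⨅ (k : ℕ) (_ : ω k = y), (k : ℝ≥0∞)

/-- The hitting time `H_{x → y}`: the expected first time at which the random walk started at `x`
is at `y`. -/
def hittingTime {V : Type u} [Fintype V] [MeasurableSpace V] [DiscreteMeasurableSpace V]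
    (G : SimpleGraph V) (x y : V) : ℝ≥0∞ :=
  ∫⁻ ω, firstVisit y ω ∂(walkLaw G x)

/-- The mean hitting time `(1 / (|V| (|V| - 1))) ∑_{x,y} H_{x → y}`. -/
def meanHittingTime {V : Type u} [Fintype V] [MeasurableSpace V] [DiscreteMeasurableSpace V]
    (G : SimpleGraph V) : ℝ≥0∞ :=
  (∑ x : V, ∑ y : V, hittingTime G x y) /
    ((Fintype.card V : ℝ≥0∞) * ((Fintype.card V : ℝ≥0∞) - 1))

/-! ### The T-fractal operation -/

/-- Vertices after the `m`-order T-fractal operation: the old vertices, a new vertex `w` for each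
edge, and `m` further new vertices `w_1, …, w_m` for each edge. -/
abbrev TFractalVertex {V : Type u} (G : SimpleGraph V) (m : ℕ) : Type u :=
  V ⊕ (G.edgeSet ⊕ (G.edgeSet × Fin m))

/-- One orientation of the edges after the operation. -/
def tFractalRel {V : Type u} (G : SimpleGraph V) (m : ℕ) :
    TFractalVertex G m → TFractalVertex G m → Prop
  | .inl x, .inr (.inl e) => x ∈ (e : Sym2 V)
  | .inr (.inl e), .inr (.inr (e', _)) => e = e'
  | _, _ => False

/-- The `m`-order T-fractal operation applied to every edge of `G`: each edge `xy` is replaced by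
the edges `xw`, `wy` through a new vertex `w`, to which `m` new leaves are attached. -/
def tFractalGraph {V : Type u} (G : SimpleGraph V) (m : ℕ) : SimpleGraph (TFractalVertex G m) :=
  SimpleGraph.fromRel (tFractalRel G m)

/-- A finite simple graph bundled with its vertex type. -/
structure FiniteGraph : Type (u + 1) where
  Vertex : Type u
  [fintypeVertex : Fintype Vertex]
  graph : SimpleGraph Vertex

instance FiniteGraph.instFintypeVertex (G : FiniteGraph.{u}) : Fintype G.Vertex :=
  G.fintypeVertex

/-- Vertex sets carry the discrete σ-algebra. -/
instance FiniteGraph.instMeasurableSpaceVertex (G : FiniteGraph.{u}) : MeasurableSpace G.Vertex :=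
  ⊤

instance FiniteGraph.instDiscreteMeasurableSpaceVertex (G : FiniteGraph.{u}) :
    DiscreteMeasurableSpace G.Vertex :=
  ⟨fun _ => trivial⟩

/-- The number `|G|` of vertices. -/
def FiniteGraph.order (G : FiniteGraph.{u}) : ℕ := Fintype.card G.Vertex

open Classical in
/-- The `m`-order T-fractal operation on bundled finite graphs. -/
def FiniteGraph.tFractalStep (m : ℕ) (G : FiniteGraph.{u}) : FiniteGraph.{u} where
  Vertex := TFractalVertex G.graph m
  fintypeVertex := inferInstance
  graph := tFractalGraph G.graph m

/-- The generalized T-fractal: the seed at `t = 0`, followed by `t` iterations of the `m`-order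
T-fractal operation. -/
def generalizedTFractal (m : ℕ) (T : FiniteGraph.{u}) : ℕ → FiniteGraph.{u}
  | 0 => T
  | t + 1 => (generalizedTFractal m T t).tFractalStep m

end

/-! On a tree, (d(x,y) + d(z,y) - d(x,z))/2 is the number of edges shared by the paths from x and
from z to y. Weighting it by deg z and summing over z gives H_{x→y}: each summand is the expected
number of visits to z before y is reached. This candidate, `treeHitting`, satisfies the first-step
equations, and a finite solution of those equations is the hitting time
(`hittingTime_eq_of_first_step`). Summed over x and y, the last two distance terms cancel, so the
mean hitting time of a tree is 2W/|V| (`meanHittingTime_tree`).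

It remains to follow W under the T-fractal operation, which keeps trees trees. Old distances double;
distances from a new middle vertex average those from the two ends of its edge; a leaf adds 1. The
resulting sums over edges become degree-weighted distance sums, which `sum_degree_mul_dist`
evaluates. This gives the one-step recursion `wienerIndex_tFractalGraph`, and unrolling it gives the
formula. -/

/-! ### Degrees and distances in a finite tree. -/

section Tree

variable {V : Type u} {G : SimpleGraph V}

/-- In a tree, a vertex `x ≠ z` has exactly one neighbour closer to `z`. -/
theorem SimpleGraph.IsTree.exists_parent (hG : G.IsTree) {x z : V} (hxz : x ≠ z) :
    ∃ p, G.Adj x p ∧ G.dist p z + 1 = G.dist x z ∧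
      ∀ u, G.Adj x u → u ≠ p → G.dist u z = G.dist x z + 1 := by
  classical
  -- A closer neighbour u followed by a geodesic is a path from x to z; uniqueness of paths makes u
  -- the second vertex of every such path.
  have key : ∀ u, G.Adj x u → G.dist x z = G.dist u z + 1 →
      ∀ q : G.Walk x z, q.IsPath → u = q.snd := by
    intro u hu hd q hq
    obtain ⟨r, hr⟩ := hG.connected.exists_walk_length_eq_dist u z
    have hc : (SimpleGraph.Walk.cons hu r).IsPath :=
      SimpleGraph.Walk.isPath_of_length_eq_dist _ (by simp [hr, hd])
    have h2 := (hG.isAcyclic.subsingleton_path x z).elim ⟨_, hc⟩ ⟨q, hq⟩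
    have h3 : SimpleGraph.Walk.cons hu r = q := congrArg Subtype.val h2
    rw [← h3]; simp
  obtain ⟨w, hw⟩ := hG.connected.exists_walk_length_eq_dist x z
  have hwp : w.IsPath := SimpleGraph.Walk.isPath_of_length_eq_dist _ hw
  cases w with
  | nil => exact absurd rfl hxz
  | @cons _ p _ hp r =>
    have h1 : G.dist p z ≤ r.length := SimpleGraph.dist_le r
    simp only [SimpleGraph.Walk.length_cons] at hw
    have hdp : G.dist x z = G.dist p z + 1 := by
      have := hG.dist_eq_dist_add_one_of_adj z hp
      rw [SimpleGraph.dist_comm (u := z), SimpleGraph.dist_comm (u := z)] at this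
      omega
    refine ⟨p, hp, hdp.symm, fun u hu hne => ?_⟩
    have := hG.dist_eq_dist_add_one_of_adj z hu
    rw [SimpleGraph.dist_comm (u := z), SimpleGraph.dist_comm (u := z)] at this
    rcases this with h | h
    · exact absurd (by simpa using key u hu h _ hwp) hne
    · exact h

open Classical in
theorem SimpleGraph.sum_adj_const [Fintype V] (x : V) (c : ℝ) :
    ∑ u, (if G.Adj x u then c else 0) = G.degree x * c := by
  rw [← Finset.sum_filter, ← SimpleGraph.neighborFinset_eq_filter, Finset.sum_const,
    SimpleGraph.card_neighborFinset_eq_degree, nsmul_eq_mul]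

-- The parent contributes d - 1 and every other neighbour d + 1.
open Classical in
theorem SimpleGraph.IsTree.sum_adj_dist [Fintype V] (hG : G.IsTree) {x z : V} (hxz : x ≠ z) :
    ∑ u, (if G.Adj x u then (G.dist u z : ℝ) else 0) = G.degree x * (G.dist x z + 1) - 2 := by
  obtain ⟨p, hp, hd, hu⟩ := hG.exists_parent hxz
  rw [← SimpleGraph.sum_adj_const]
  have : (2 : ℝ) = ∑ u, if u = p then 2 else 0 := by simp
  rw [this, ← Finset.sum_sub_distrib]
  refine Finset.sum_congr rfl fun u _ => ?_
  by_cases h : u = p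
  · subst h
    rw [← hd]; simp [hp]; ring
  · by_cases ha : G.Adj x u
    · simp [ha, h, hu u ha h]
    · simp [ha, h]

open Classical in
theorem SimpleGraph.IsTree.sum_degree [Fintype V] (hG : G.IsTree) :
    ∑ x, (G.degree x : ℝ) = 2 * ((Fintype.card V : ℝ) - 1) := by
  have h1 := G.sum_degrees_eq_twice_card_edges
  have h2 := hG.card_edgeFinset
  rw [← h2]
  push_cast
  rw [← Nat.cast_sum, h1]
  push_cast; ring

-- Two evaluations of the Dirichlet energy of d = d(·, z) over ordered adjacent pairs. Each
-- difference is ±1, so it equals 2(|V| - 1); summation by parts with `sum_adj_dist` gives 2 ∑ (2 d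
-- - deg · d), the vertex z causing no exception because d vanishes there.
open Classical in
theorem SimpleGraph.IsTree.sum_degree_mul_dist [Fintype V] (hG : G.IsTree) (z : V) :
    ∑ x, (G.degree x : ℝ) * G.dist x z = 2 * ∑ x, (G.dist x z : ℝ) - ((Fintype.card V : ℝ) - 1) := by
  set d : V → ℝ := fun x => G.dist x z with hdef
  have h1 : ∑ x, ∑ u, (if G.Adj x u then (d x - d u) ^ 2 else 0) =
      2 * ((Fintype.card V : ℝ) - 1) := by
    rw [← hG.sum_degree]
    refine Finset.sum_congr rfl fun x _ => ?_
    rw [← mul_one (G.degree x : ℝ), ← SimpleGraph.sum_adj_const]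
    refine Finset.sum_congr rfl fun u _ => ?_
    split_ifs with h
    · have := hG.dist_eq_dist_add_one_of_adj z h
      rw [SimpleGraph.dist_comm (u := z), SimpleGraph.dist_comm (u := z)] at this
      rcases this with h | h <;> simp only [hdef, h] <;> push_cast <;> ring
    · rfl
  have h2 : ∀ x, ∑ u, (if G.Adj x u then d x * (d x - d u) else 0) =
      2 * d x - G.degree x * d x := by
    intro x
    by_cases hx : x = z
    · have : d x = 0 := by simp [hdef, hx]
      simp [this]
    · have h3 := hG.sum_adj_dist hx
      have h4 := SimpleGraph.sum_adj_const (G := G) x (d x)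
      have : ∑ u, (if G.Adj x u then d x * (d x - d u) else 0) =
          d x * (∑ u, (if G.Adj x u then d x else 0) - ∑ u, (if G.Adj x u then d u else 0)) := by
        rw [← Finset.sum_sub_distrib, Finset.mul_sum]
        refine Finset.sum_congr rfl fun u _ => ?_
        split_ifs <;> ring
      rw [this, h3, h4]; ring
  have h3 : ∑ x, ∑ u, (if G.Adj x u then (d x - d u) ^ 2 else 0) =
      ∑ x, ∑ u, (if G.Adj x u then d x * (d x - d u) else 0) +
      ∑ x, ∑ u, (if G.Adj x u then d x * (d x - d u) else 0) := by
    conv_rhs => enter [2]; rw [Finset.sum_comm]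
    simp only [← Finset.sum_add_distrib]
    refine Finset.sum_congr rfl fun x _ => Finset.sum_congr rfl fun u _ => ?_
    by_cases h : G.Adj x u
    · simp [h, h.symm]; ring
    · have h' : ¬ G.Adj u x := fun k => h k.symm
      simp [h, h']
  simp only [h2] at h3
  rw [Finset.sum_sub_distrib, ← Finset.mul_sum] at h3
  linarith

open Classical in
theorem sum_mem_edge (e : G.edgeSet) [Fintype V] (f : V → ℝ) {x y : V} (h : (e : Sym2 V) = s(x, y)) :
    ∑ a, (if a ∈ (e : Sym2 V) then f a else 0) = f x + f y := by
  have hxy : x ≠ y := by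
    have := e.2
    rw [h, SimpleGraph.mem_edgeSet] at this
    exact this.ne
  rw [← Finset.sum_filter, h, ← Finset.sum_pair hxy]
  congr 1
  ext a; simp

open Classical in
theorem sum_edge_mem [Fintype V] [Fintype G.edgeSet] (a : V) (c : ℝ) :
    ∑ e : G.edgeSet, (if a ∈ (e : Sym2 V) then c else 0) = G.degree a * c := by
  rw [← Finset.sum_filter, Finset.sum_const, nsmul_eq_mul, ← SimpleGraph.card_incidenceFinset_eq_degree]
  congr 2
  refine Finset.card_bij (fun e _ => (e : Sym2 V)) ?_ ?_ ?_
  · rintro ⟨e, he⟩ h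
    simpa [SimpleGraph.mem_incidenceFinset, SimpleGraph.incidenceSet, he] using h
  · rintro e _ e' _ h
    exact Subtype.ext h
  · intro e he
    rw [SimpleGraph.mem_incidenceFinset] at he
    exact ⟨⟨e, he.1⟩, by simpa using he.2, rfl⟩

open Classical in
theorem sum_edge_sum_mem [Fintype V] [Fintype G.edgeSet] (f : V → ℝ) :
    ∑ e : G.edgeSet, ∑ a, (if a ∈ (e : Sym2 V) then f a else 0) = ∑ a, G.degree a * f a := by
  rw [Finset.sum_comm]
  simp only [sum_edge_mem]

end Tree

/-! ### Hitting times from the first-step equations. -/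

section Hitting

variable {V : Type u} [Fintype V] [MeasurableSpace V] [DiscreteMeasurableSpace V]

theorem map_frestrictLe_zero_walkLaw (G : SimpleGraph V) (x : V) :
    (walkLaw G x).map (Preorder.frestrictLe (π := fun _ => V) 0) = Measure.dirac (fun _ => x) := by
  unfold walkLaw Kernel.trajMeasure
  have e : (Measure.dirac x).map (MeasurableEquiv.piUnique fun _ : Finset.Iic 0 => V).symm =
      Measure.dirac fun _ => x := by
    rw [Measure.map_dirac' (MeasurableEquiv.measurable _)]
    rfl
  have e' := congrArg (fun μ => (μ.bind (Kernel.traj (X := fun _ => V) (walkHistoryKernel G) 0)).map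
    (Preorder.frestrictLe (π := fun _ => V) 0)) e
  refine e'.trans ?_
  rw [Measure.dirac_bind (Kernel.measurable _), Kernel.traj_map_frestrictLe_apply,
    Kernel.partialTraj_self, Kernel.id_apply]

theorem lintegral_walkLaw_zero (G : SimpleGraph V) (x : V) (f : V → ℝ≥0∞) :
    ∫⁻ ω, f (ω 0) ∂(walkLaw G x) = f x := by
  have hf := measurable_of_countable f
  have h : ∫⁻ h, f (h ⟨0, by simp⟩)
      ∂((walkLaw G x).map (Preorder.frestrictLe (π := fun _ => V) 0)) = f x := by
    rw [map_frestrictLe_zero_walkLaw, lintegral_dirac' _ (by fun_prop)]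
  rw [lintegral_map (by fun_prop) (by fun_prop)] at h
  exact h

/-- Markov property at time `k`, for a functional of the past times a function of the next step. -/
theorem lintegral_walkLaw_succ (G : SimpleGraph V) (x : V) (k : ℕ)
    (φ : (Finset.Iic k → V) → ℝ≥0∞) (hφ : Measurable φ) (f : V → ℝ≥0∞) :
    ∫⁻ ω, φ (Preorder.frestrictLe (π := fun _ => V) k ω) * f (ω (k + 1)) ∂(walkLaw G x) =
      ∫⁻ ω, φ (Preorder.frestrictLe (π := fun _ => V) k ω) *
        ∫⁻ v, f v ∂(walkKernel G (ω k)) ∂(walkLaw G x) := by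
  have hf := measurable_of_countable f
  have hF : Measurable fun p : (Finset.Iic k → V) × V => φ p.1 * f p.2 := by fun_prop
  have key := Kernel.map_frestrictLe_trajMeasure_compProd_eq_map_trajMeasure
    (X := fun _ => V) (μ₀ := Measure.dirac x) (κ := walkHistoryKernel G) (a := k)
  have h2 := congrArg (fun μ => ∫⁻ p, φ p.1 * f p.2 ∂μ) key
  rw [Measure.lintegral_compProd hF, lintegral_map hF (by fun_prop)] at h2
  rw [lintegral_map hF.lintegral_kernel_prod_right' (by fun_prop)] at h2
  refine h2.symm.trans (lintegral_congr fun ω => ?_)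
  exact lintegral_const_mul (μ := walkKernel G (ω k))
    (φ (Preorder.frestrictLe (π := fun _ => V) k ω)) hf

open Classical in
/-- Indicator that the trajectory avoids `y` up to time `k`. -/
noncomputable def avoids (y : V) (k : ℕ) (h : Finset.Iic k → V) : ℝ≥0∞ :=
  if ∀ i, h i ≠ y then 1 else 0

theorem measurable_avoids (y : V) (k : ℕ) : Measurable (avoids y k) := by
  classical
  exact measurable_of_countable _

/-- Expectation of `f` at time `k` on the event that `y` has not been visited by then. -/
noncomputable def avoidingMean (G : SimpleGraph V) (x y : V) (k : ℕ) (f : V → ℝ≥0∞) : ℝ≥0∞ :=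
  ∫⁻ ω, avoids y k (Preorder.frestrictLe (π := fun _ => V) k ω) * f (ω k) ∂(walkLaw G x)

omit [Fintype V] [MeasurableSpace V] [DiscreteMeasurableSpace V] in
theorem avoids_frestrictLe (y : V) (k : ℕ) (ω : ℕ → V) [Decidable (∀ i ≤ k, ω i ≠ y)] :
    avoids y k (Preorder.frestrictLe (π := fun _ => V) k ω) = if ∀ i ≤ k, ω i ≠ y then 1 else 0 := by
  unfold avoids
  congr 1
  simp [Preorder.frestrictLe]

-- A first visit at time N leaves exactly the N times 0, …, N - 1 without a visit so far; with no
-- visit at all every term is 1 and both sides are infinite.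
omit [Fintype V] [MeasurableSpace V] [DiscreteMeasurableSpace V] in
theorem firstVisit_eq_tsum (y : V) (ω : ℕ → V) :
    firstVisit y ω = ∑' k, avoids y k (Preorder.frestrictLe (π := fun _ => V) k ω) := by
  classical
  simp only [avoids_frestrictLe]
  by_cases h : ∃ k, ω k = y
  · have hmin : firstVisit y ω = (Nat.find h : ℝ≥0∞) := by
      refine le_antisymm (iInf₂_le (Nat.find h) (Nat.find_spec h)) (le_iInf₂ fun k hk => ?_)
      exact_mod_cast Nat.find_min' h hk
    have hi : ∀ k, (∀ i ≤ k, ω i ≠ y) ↔ k ∈ Finset.range (Nat.find h) := by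
      intro k
      simp [Nat.lt_find_iff]
    simp only [hi]
    rw [hmin, tsum_eq_sum (s := Finset.range (Nat.find h)) (fun k hk => by simp [hk]),
      Finset.sum_congr rfl (fun k hk => if_pos hk)]
    simp
  · push Not at h
    simp [firstVisit, h]

theorem hittingTime_eq_tsum (G : SimpleGraph V) (x y : V) :
    hittingTime G x y = ∑' k, avoidingMean G x y k 1 := by
  unfold hittingTime avoidingMean
  rw [← lintegral_tsum]
  · refine lintegral_congr fun ω => ?_
    rw [firstVisit_eq_tsum]; simp
  · intro k
    have := measurable_avoids y k
    simp only [Pi.one_apply, mul_one]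
    fun_prop

/-- Since g vanishes at y, avoidance at time k + 1 itself need not be imposed; the Markov property
at time k and the first-step equation then apply. Iterated, this telescopes. -/
theorem avoidingMean_step (G : SimpleGraph V) (x y : V) (k : ℕ) (g : V → ℝ≥0∞) (hy : g y = 0)
    (hg : ∀ z, z ≠ y → g z = 1 + ∫⁻ v, g v ∂(walkKernel G z)) :
    avoidingMean G x y k g = avoidingMean G x y k 1 + avoidingMean G x y (k + 1) g := by
  classical
  have hm := measurable_avoids y k
  have h1 : avoidingMean G x y (k + 1) g =
      ∫⁻ ω, avoids y k (Preorder.frestrictLe (π := fun _ => V) k ω) * g (ω (k + 1))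
        ∂(walkLaw G x) := by
    refine lintegral_congr fun ω => ?_
    simp only [avoids_frestrictLe]
    by_cases h : ω (k + 1) = y
    · simp [h, hy]
    · have : (∀ i ≤ k + 1, ω i ≠ y) ↔ ∀ i ≤ k, ω i ≠ y := by
        refine ⟨fun H i hi => H i (by omega), fun H i hi => ?_⟩
        rcases Nat.le_succ_iff.1 hi with h' | h'
        · exact H i h'
        · subst h'; exact h
      simp only [this]
  rw [h1, lintegral_walkLaw_succ G x k _ hm g]
  unfold avoidingMean
  rw [← lintegral_add_left (by simp only [Pi.one_apply, mul_one]; fun_prop)]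
  refine lintegral_congr fun ω => ?_
  by_cases h : ω k = y
  · have : avoids y k (Preorder.frestrictLe (π := fun _ => V) k ω) = 0 := by
      rw [avoids_frestrictLe, if_neg]
      exact fun H => H k le_rfl h
    simp [this]
  · rw [hg _ h, mul_add]; simp

/-- A finite solution of the first-step equations is the hitting time. -/
theorem hittingTime_eq_of_first_step (G : SimpleGraph V) (y : V) (g : V → ℝ≥0∞) (hy : g y = 0)
    (hfin : ∀ z, g z ≠ ⊤) (hg : ∀ z, z ≠ y → g z = 1 + ∫⁻ v, g v ∂(walkKernel G z)) (x : V) :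
    hittingTime G x y = g x := by
  classical
  have h0 : avoidingMean G x y 0 g = g x := by
    rw [← lintegral_walkLaw_zero G x g]
    refine lintegral_congr fun ω => ?_
    rw [avoids_frestrictLe]
    by_cases h : ω 0 = y <;> simp [h, hy]
  have hsum : ∀ k, g x = ∑ j ∈ Finset.range k, avoidingMean G x y j 1 + avoidingMean G x y k g := by
    intro k
    induction k with
    | zero => simp [h0]
    | succ k ih => rw [ih, avoidingMean_step G x y k g hy hg, Finset.sum_range_succ, add_assoc]
  have hle : ∑' k, avoidingMean G x y k 1 ≤ g x := by
    refine ENNReal.tsum_le_of_sum_range_le fun k => ?_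
    conv_rhs => rw [hsum k]
    exact le_self_add
  have hne : ∑' k, avoidingMean G x y k 1 ≠ ⊤ := ne_top_of_le_ne_top (hfin x) hle
  have ht : Filter.Tendsto (fun k => avoidingMean G x y k 1) Filter.atTop (nhds 0) :=
    ENNReal.tendsto_atTop_zero_of_tsum_ne_top hne
  have hC : (∑ z, g z) ≠ ⊤ := by simp [ENNReal.sum_eq_top, hfin]
  -- On a finite vertex set g is bounded by its total sum, so the remainder is at most a constant
  -- times the avoidance probability, which tends to 0 as the term of a convergent series.
  have hb : ∀ k, avoidingMean G x y k g ≤ (∑ z, g z) * avoidingMean G x y k 1 := by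
    intro k
    unfold avoidingMean
    rw [← lintegral_const_mul' _ _ hC]
    refine lintegral_mono fun ω => ?_
    simp only [Pi.one_apply, mul_one]
    rw [mul_comm]
    gcongr
    exact Finset.single_le_sum (f := g) (fun _ _ => zero_le) (Finset.mem_univ (ω k))
  have ht2 : Filter.Tendsto (fun k => avoidingMean G x y k g) Filter.atTop (nhds 0) := by
    refine tendsto_of_tendsto_of_tendsto_of_le_of_le tendsto_const_nhds ?_ (fun _ => zero_le) hb
    simpa using ENNReal.Tendsto.const_mul ht (Or.inr hC)
  have ht3 := (ENNReal.summable (f := fun k => avoidingMean G x y k 1)).hasSum.tendsto_sum_nat.add ht2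
  rw [hittingTime_eq_tsum]
  simp only [← hsum, add_zero] at ht3
  exact (tendsto_nhds_unique ht3 tendsto_const_nhds)

open Classical in
theorem lintegral_walkKernel (G : SimpleGraph V) (z : V) (h : (G.neighborFinset z).Nonempty)
    (g : V → ℝ) (hg : ∀ v, 0 ≤ g v) :
    ∫⁻ v, ENNReal.ofReal (g v) ∂(walkKernel G z) =
      ENNReal.ofReal ((∑ v, if G.Adj z v then g v else 0) / G.degree z) := by
  have h1 : walkKernel G z = (PMF.uniformOfFinset (G.neighborFinset z) h).toMeasure := by
    change (walkStep G z).toMeasure = _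
    unfold walkStep
    rw [dif_pos h]
  have hd : (0 : ℝ) < G.degree z := by
    rw [← SimpleGraph.card_neighborFinset_eq_degree]
    exact_mod_cast h.card_pos
  rw [h1, lintegral_fintype, Finset.sum_div, ENNReal.ofReal_sum_of_nonneg]
  · refine Finset.sum_congr rfl fun v _ => ?_
    rw [PMF.toMeasure_apply_singleton _ _ (measurableSet_singleton v)]
    by_cases hv : G.Adj z v
    · rw [PMF.uniformOfFinset_apply_of_mem _ (by simpa using hv), if_pos hv,
        ENNReal.ofReal_div_of_pos hd, ENNReal.ofReal_natCast,
        SimpleGraph.card_neighborFinset_eq_degree, div_eq_mul_inv]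
    · rw [PMF.uniformOfFinset_apply_of_notMem _ (by simpa using hv)]
      simp [hv]
  · intro v _
    split_ifs
    · exact div_nonneg (hg v) hd.le
    · simp

/-! ### Hitting times and mean hitting time of a tree. -/

open Classical in
/-- The hitting time of a tree, in terms of distances. -/
noncomputable def treeHitting (G : SimpleGraph V) (x y : V) : ℝ :=
  ∑ z, (G.degree z : ℝ) * ((G.dist x y + G.dist z y - G.dist x z) / 2)

omit [MeasurableSpace V] [DiscreteMeasurableSpace V] in
theorem treeHitting_nonneg {G : SimpleGraph V} (hG : G.IsTree) (x y : V) :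
    0 ≤ treeHitting G x y := by
  refine Finset.sum_nonneg fun z _ => mul_nonneg (by positivity) ?_
  have := hG.connected.dist_triangle (u := x) (v := y) (w := z)
  rw [SimpleGraph.dist_comm (u := y)] at this
  have : (G.dist x z : ℝ) ≤ G.dist x y + G.dist z y := by exact_mod_cast this
  linarith

omit [MeasurableSpace V] [DiscreteMeasurableSpace V] in
open Classical in
theorem sum_adj_treeHitting {G : SimpleGraph V} (hG : G.IsTree) {x y : V} (hxy : x ≠ y) :
    ∑ v, (if G.Adj x v then treeHitting G v y else 0) = G.degree x * (treeHitting G x y - 1) := by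
  -- The correction at z = x is 2: there all neighbours are at distance 1 and the sum is deg x, not
  -- deg x - 2. Elsewhere the -2 cancels against the one from d(·, y), so only z = x produces the -1
  -- of the first-step equation.
  have hz : ∀ z, ∑ v, (if G.Adj x v then (G.dist v z : ℝ) else 0) =
      G.degree x * (G.dist x z + 1) - 2 + if z = x then 2 - (G.degree x : ℝ) + G.degree x else 0 := by
    intro z
    by_cases h : x = z
    · subst h
      rw [SimpleGraph.dist_self]
      simp only [if_true]
      rw [Finset.sum_congr rfl (g := fun v => if G.Adj x v then (1 : ℝ) else 0),
        SimpleGraph.sum_adj_const]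
      · simp
      · intro v _
        split_ifs with hv
        · have := SimpleGraph.dist_eq_one_iff_adj.2 hv.symm
          simp [this]
        · rfl
    · rw [hG.sum_adj_dist h]
      simp [Ne.symm h]
  have h1 : ∑ v, (if G.Adj x v then treeHitting G v y else 0) =
      ∑ z, (G.degree z : ℝ) * ((∑ v, (if G.Adj x v then (G.dist v y : ℝ) else 0)
        + ∑ v, (if G.Adj x v then (G.dist z y : ℝ) else 0)
        - ∑ v, (if G.Adj x v then (G.dist v z : ℝ) else 0)) / 2) := by
    simp only [← Finset.sum_add_distrib, ← Finset.sum_sub_distrib, Finset.sum_div, Finset.mul_sum]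
    rw [Finset.sum_comm]
    refine Finset.sum_congr rfl fun v _ => ?_
    split_ifs
    · rfl
    · simp
  rw [h1]
  simp only [hz, SimpleGraph.sum_adj_const]
  have h2 : (G.degree x : ℝ) * (treeHitting G x y - 1) =
      ∑ z, ((G.degree z : ℝ) * (G.degree x * ((G.dist x y + G.dist z y - G.dist x z) / 2)) -
        if z = x then (G.degree x : ℝ) else 0) := by
    rw [Finset.sum_sub_distrib]
    simp only [Finset.sum_ite_eq', Finset.mem_univ, if_true, treeHitting]
    rw [mul_sub, mul_one, Finset.mul_sum]
    congr 1
    exact Finset.sum_congr rfl fun z _ => by ring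
  rw [h2]
  refine Finset.sum_congr rfl fun z _ => ?_
  simp only [Ne.symm hxy, if_false]
  by_cases h : z = x
  · subst h; simp; ring
  · simp only [h, if_false]; ring

theorem hittingTime_eq_treeHitting {G : SimpleGraph V} (hG : G.IsTree) (x y : V) :
    hittingTime G x y = ENNReal.ofReal (treeHitting G x y) := by
  classical
  refine hittingTime_eq_of_first_step G y (fun x => ENNReal.ofReal (treeHitting G x y)) ?_
    (fun _ => ENNReal.ofReal_ne_top) (fun z hz => ?_) x
  · simp [treeHitting, SimpleGraph.dist_comm]
  · obtain ⟨p, hp, -⟩ := hG.exists_parent hz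
    have hne : (G.neighborFinset z).Nonempty := ⟨p, by simpa using hp⟩
    have hd : (0 : ℝ) < G.degree z := by
      rw [← SimpleGraph.card_neighborFinset_eq_degree]
      exact_mod_cast hne.card_pos
    have hs := sum_adj_treeHitting hG hz
    have h0 : 0 ≤ (∑ v, if G.Adj z v then treeHitting G v y else 0) / (G.degree z : ℝ) := by
      refine div_nonneg (Finset.sum_nonneg fun v _ => ?_) hd.le
      split_ifs
      · exact treeHitting_nonneg hG v y
      · exact le_rfl
    have := lintegral_walkKernel G z (by convert hne) (fun v => treeHitting G v y)
      (fun v => treeHitting_nonneg hG v y)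
    rw [this, ← ENNReal.ofReal_one, ← ENNReal.ofReal_add zero_le_one h0]
    congr 1
    rw [hs]
    field_simp
    ring

-- The terms deg z · d(z,y) and deg z · d(x,z) have equal sums over all triples and cancel, leaving
-- the degree sum times W.
omit [MeasurableSpace V] [DiscreteMeasurableSpace V] in
theorem sum_treeHitting {G : SimpleGraph V} (hG : G.IsTree) :
    ∑ x, ∑ y, treeHitting G x y = 2 * ((Fintype.card V : ℝ) - 1) * wienerIndex G := by
  classical
  have h1 : ∑ x, ∑ y, treeHitting G x y =
      (∑ z, (G.degree z : ℝ)) * (∑ x, ∑ y, (G.dist x y : ℝ)) / 2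
      + ((∑ x : V, ∑ y, ∑ z, (G.degree z : ℝ) * G.dist z y)
        - ∑ x, ∑ y : V, ∑ z, (G.degree z : ℝ) * G.dist z x) / 2 := by
    rw [Finset.sum_mul_sum]
    simp only [Finset.mul_sum, treeHitting]
    conv_rhs => enter [1, 1]; rw [Finset.sum_comm]; enter [2, x]; rw [Finset.sum_comm]
    simp only [← Finset.sum_sub_distrib, ← Finset.sum_add_distrib, Finset.sum_div]
    refine Finset.sum_congr rfl fun x _ => Finset.sum_congr rfl fun y _ =>
      Finset.sum_congr rfl fun z _ => ?_
    rw [SimpleGraph.dist_comm (u := z) (v := x)]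
    ring
  rw [h1, hG.sum_degree]
  have h2 : (∑ x : V, ∑ y, ∑ z, (G.degree z : ℝ) * G.dist z y)
      = ∑ x, ∑ y : V, ∑ z, (G.degree z : ℝ) * G.dist z x := by
    rw [Finset.sum_comm]
  rw [h2]
  unfold wienerIndex
  ring

theorem meanHittingTime_tree {G : SimpleGraph V} (hG : G.IsTree) (hn : 2 ≤ Fintype.card V) :
    meanHittingTime G ≠ ⊤ ∧
      (meanHittingTime G).toReal = 2 / (Fintype.card V : ℝ) * wienerIndex G := by
  have hn' : (2 : ℝ) ≤ Fintype.card V := by exact_mod_cast hn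
  have h1 : meanHittingTime G = ENNReal.ofReal (2 / (Fintype.card V : ℝ) * wienerIndex G) := by
    unfold meanHittingTime
    simp only [hittingTime_eq_treeHitting hG]
    simp only [← ENNReal.ofReal_sum_of_nonneg (fun y _ => treeHitting_nonneg hG _ y)]
    rw [← ENNReal.ofReal_sum_of_nonneg
      (fun x _ => Finset.sum_nonneg fun y _ => treeHitting_nonneg hG x y), sum_treeHitting hG]
    have h2 : ((Fintype.card V : ℝ≥0∞) * ((Fintype.card V : ℝ≥0∞) - 1)) =
        ENNReal.ofReal ((Fintype.card V : ℝ) * ((Fintype.card V : ℝ) - 1)) := by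
      rw [ENNReal.ofReal_mul (by positivity), ENNReal.ofReal_sub _ zero_le_one]
      simp
    rw [h2, ← ENNReal.ofReal_div_of_pos (by nlinarith)]
    congr 1
    have : (Fintype.card V : ℝ) - 1 ≠ 0 := by linarith
    field_simp
  have h3 : 0 ≤ wienerIndex G := by unfold wienerIndex; positivity
  rw [h1]
  exact ⟨ENNReal.ofReal_ne_top, ENNReal.toReal_ofReal (by positivity)⟩

end Hitting

/-! ### One T-fractal operation: tree structure, distances and Wiener index. -/

section TFractal

variable {V : Type u} {G : SimpleGraph V} {m : ℕ}

@[simp] theorem tFractalGraph_adj_old_old (x y : V) :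
    ¬ (tFractalGraph G m).Adj (.inl x) (.inl y) := by
  simp [tFractalGraph, tFractalRel]

@[simp] theorem tFractalGraph_adj_old_mid (x : V) (e : G.edgeSet) :
    (tFractalGraph G m).Adj (.inl x) (.inr (.inl e)) ↔ x ∈ (e : Sym2 V) := by
  simp [tFractalGraph, tFractalRel]

@[simp] theorem tFractalGraph_adj_mid_old (x : V) (e : G.edgeSet) :
    (tFractalGraph G m).Adj (.inr (.inl e)) (.inl x) ↔ x ∈ (e : Sym2 V) := by
  simp [tFractalGraph, tFractalRel]

@[simp] theorem tFractalGraph_adj_old_leaf (x : V) (p : G.edgeSet × Fin m) :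
    ¬ (tFractalGraph G m).Adj (.inl x) (.inr (.inr p)) := by
  simp [tFractalGraph, tFractalRel]

@[simp] theorem tFractalGraph_adj_leaf_old (x : V) (p : G.edgeSet × Fin m) :
    ¬ (tFractalGraph G m).Adj (.inr (.inr p)) (.inl x) := by
  simp [tFractalGraph, tFractalRel]

@[simp] theorem tFractalGraph_adj_mid_mid (e f : G.edgeSet) :
    ¬ (tFractalGraph G m).Adj (.inr (.inl e)) (.inr (.inl f)) := by
  simp [tFractalGraph, tFractalRel]

@[simp] theorem tFractalGraph_adj_mid_leaf (e : G.edgeSet) (p : G.edgeSet × Fin m) :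
    (tFractalGraph G m).Adj (.inr (.inl e)) (.inr (.inr p)) ↔ p.1 = e := by
  simp [tFractalGraph, tFractalRel, eq_comm]

@[simp] theorem tFractalGraph_adj_leaf_mid (e : G.edgeSet) (p : G.edgeSet × Fin m) :
    (tFractalGraph G m).Adj (.inr (.inr p)) (.inr (.inl e)) ↔ p.1 = e := by
  simp [tFractalGraph, tFractalRel, eq_comm]

@[simp] theorem tFractalGraph_adj_leaf_leaf (p q : G.edgeSet × Fin m) :
    ¬ (tFractalGraph G m).Adj (.inr (.inr p)) (.inr (.inr q)) := by
  simp [tFractalGraph, tFractalRel]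

/-- A walk in `G` subdivides to a walk of twice the length. -/
theorem tFractalGraph_exists_walk {x y : V} (w : G.Walk x y) :
    ∃ w' : (tFractalGraph G m).Walk (.inl x) (.inl y), w'.length = 2 * w.length := by
  induction w with
  | nil => exact ⟨.nil, rfl⟩
  | @cons a b c h r ih =>
    obtain ⟨w', hw'⟩ := ih
    let e : G.edgeSet := ⟨s(a, b), h⟩
    have h1 : (tFractalGraph G m).Adj (.inl a) (.inr (.inl e)) := by simp [e]
    have h2 : (tFractalGraph G m).Adj (.inr (.inl e)) (.inl b) := by simp [e]
    exact ⟨.cons h1 (.cons h2 w'), by simp [hw']; ring⟩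

theorem tFractalGraph_connected (hG : G.Connected) : (tFractalGraph G m).Connected := by
  obtain ⟨x₀⟩ := hG.nonempty
  have hold : ∀ x, (tFractalGraph G m).Reachable (.inl x) (.inl x₀) := by
    intro x
    obtain ⟨w⟩ := hG x x₀
    obtain ⟨w', -⟩ := tFractalGraph_exists_walk (m := m) w
    exact ⟨w'⟩
  have hmid : ∀ e, (tFractalGraph G m).Reachable (.inr (.inl e)) (.inl x₀) := by
    rintro ⟨e, he⟩
    induction e with
    | _ a b =>
      refine SimpleGraph.Reachable.trans (SimpleGraph.Adj.reachable ?_) (hold a)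
      simp
  have hall : ∀ u, (tFractalGraph G m).Reachable u (.inl x₀) := by
    rintro (x | e | p)
    · exact hold x
    · exact hmid e
    · refine SimpleGraph.Reachable.trans (SimpleGraph.Adj.reachable ?_) (hmid p.1)
      simp
  have : Nonempty (TFractalVertex G m) := ⟨.inl x₀⟩
  exact ⟨fun u v => (hall u).trans (hall v).symm⟩

/-- A function changing by at most one along edges is bounded by the distance. -/
theorem SimpleGraph.Walk.le_add_length {f : V → ℕ} (hf : ∀ u v, G.Adj u v → f u ≤ f v + 1) {u v : V}
    (w : G.Walk u v) : f u ≤ f v + w.length := by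
  induction w with
  | nil => simp
  | cons h r ih =>
    have := hf _ _ h
    simp only [SimpleGraph.Walk.length_cons]
    omega

/-- Sum of the distances from the endpoints of an edge to `y`. -/
noncomputable def endDist (G : SimpleGraph V) (y : V) (e : Sym2 V) : ℕ :=
  Sym2.lift ⟨fun a b => G.dist a y + G.dist b y, fun _ _ => add_comm _ _⟩ e

theorem tFractalGraph_dist_old_old (hG : G.Connected) (x y : V) :
    (tFractalGraph G m).dist (.inl x) (.inl y) = 2 * G.dist x y := by
  apply le_antisymm
  · obtain ⟨w, hw⟩ := hG.exists_walk_length_eq_dist x y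
    obtain ⟨w', hw'⟩ := tFractalGraph_exists_walk (m := m) w
    rw [← hw, ← hw']
    exact SimpleGraph.dist_le w'
  -- A potential that vanishes at y and changes by at most 1 along edges, hence a lower bound for
  -- distance. Outside trees it need not be the distance at middle vertices; the Lipschitz bound
  -- suffices.
  · let f : TFractalVertex G m → ℕ := fun u => match u with
      | .inl x => 2 * G.dist x y
      | .inr (.inl e) => endDist G y e
      | .inr (.inr p) => endDist G y p.1 + 1
    have hend : ∀ (a : V) (e : G.edgeSet), a ∈ (e : Sym2 V) →
        2 * G.dist a y ≤ endDist G y e + 1 ∧ endDist G y e ≤ 2 * G.dist a y + 1 := by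
      rintro a ⟨e, he⟩ ha
      obtain ⟨b, rfl⟩ := ha
      have hab : G.Adj a b := he
      have h1 := hG.dist_triangle (u := a) (v := b) (w := y)
      have h2 := hG.dist_triangle (u := b) (v := a) (w := y)
      rw [SimpleGraph.dist_eq_one_iff_adj.2 hab] at h1
      rw [SimpleGraph.dist_eq_one_iff_adj.2 hab.symm] at h2
      simp only [endDist, Sym2.lift_mk]
      omega
    have hf : ∀ u v, (tFractalGraph G m).Adj u v → f u ≤ f v + 1 := by
      rintro (x | e | p) (z | e' | q) h
      · simp at h
      · exact (hend x e' (by simpa using h)).1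
      · simp at h
      · exact (hend z e (by simpa using h)).2
      · simp at h
      · have : q.1 = e := by simpa using h
        simp only [f, this]; omega
      · simp at h
      · have : p.1 = e' := by simpa using h
        simp only [f, this]; omega
      · simp at h
    obtain ⟨w, hw⟩ := (tFractalGraph_connected (m := m) hG).exists_walk_length_eq_dist
      (.inl x) (.inl y)
    have := w.le_add_length hf
    rw [hw] at this
    simpa [f] using this

variable [Fintype V] [Fintype G.edgeSet]

omit [Fintype V] [Fintype G.edgeSet] in
open Classical in
theorem tFractalGraph_degree_eq [Fintype (TFractalVertex G m)] (u : TFractalVertex G m) :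
    ((tFractalGraph G m).degree u : ℝ) = ∑ v, if (tFractalGraph G m).Adj u v then 1 else 0 := by
  rw [SimpleGraph.sum_adj_const, mul_one]

open Classical in
theorem tFractalGraph_degree_old (x : V) : ((tFractalGraph G m).degree (.inl x) : ℝ) = G.degree x := by
  rw [tFractalGraph_degree_eq]
  simp only [Fintype.sum_sum_type]
  simp only [tFractalGraph_adj_old_old, tFractalGraph_adj_old_mid, tFractalGraph_adj_old_leaf,
    if_false, Finset.sum_const_zero, zero_add, add_zero, sum_edge_mem, mul_one]

omit [Fintype G.edgeSet] in
open Classical in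
theorem sum_mem_edge_one (e : G.edgeSet) : ∑ a, (if a ∈ (e : Sym2 V) then (1 : ℝ) else 0) = 2 := by
  obtain ⟨e, he⟩ := e
  induction e with
  | _ a b =>
    rw [sum_mem_edge ⟨s(a, b), he⟩ (fun _ => (1 : ℝ)) rfl]; norm_num

omit [Fintype V] in
open Classical in
theorem sum_leaves (e : G.edgeSet) (f : G.edgeSet × Fin m → ℝ) :
    ∑ p : G.edgeSet × Fin m, (if p.1 = e then f p else 0) = ∑ i, f (e, i) := by
  rw [Fintype.sum_prod_type, Finset.sum_comm]
  simp

open Classical in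
theorem tFractalGraph_degree_mid (e : G.edgeSet) :
    ((tFractalGraph G m).degree (.inr (.inl e)) : ℝ) = m + 2 := by
  rw [tFractalGraph_degree_eq]
  simp only [Fintype.sum_sum_type]
  simp only [tFractalGraph_adj_mid_old, tFractalGraph_adj_mid_mid, tFractalGraph_adj_mid_leaf,
    if_false, Finset.sum_const_zero, zero_add, sum_mem_edge_one, sum_leaves]
  simp
  ring

open Classical in
theorem tFractalGraph_degree_leaf (p : G.edgeSet × Fin m) :
    ((tFractalGraph G m).degree (.inr (.inr p)) : ℝ) = 1 := by
  rw [tFractalGraph_degree_eq]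
  simp only [Fintype.sum_sum_type]
  simp

omit [Fintype V] in
theorem card_tFractalVertex [Fintype V] : Fintype.card (TFractalVertex G m) =
    Fintype.card V + (m + 1) * Fintype.card G.edgeSet := by
  simp only [Fintype.card_sum, Fintype.card_prod, Fintype.card_fin]
  ring

theorem SimpleGraph.IsTree.card_edgeSet (hG : G.IsTree) :
    Fintype.card G.edgeSet + 1 = Fintype.card V := by
  rw [← hG.card_edgeFinset, SimpleGraph.edgeFinset, Set.toFinset_card]

/-- Connectedness plus an edge count; the edges are counted by the degree sum 2E + (m + 2)E + mE,
where E is the number of old edges. -/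
theorem tFractalGraph_isTree (hG : G.IsTree) : (tFractalGraph G m).IsTree := by
  classical
  rw [SimpleGraph.isTree_iff_connected_and_card]
  refine ⟨tFractalGraph_connected hG.connected, ?_⟩
  have h1 := (tFractalGraph G m).sum_degrees_eq_twice_card_edges
  have h2 : ∑ u, ((tFractalGraph G m).degree u : ℝ) =
      2 * ((m + 2) * (Fintype.card G.edgeSet : ℝ)) := by
    simp only [Fintype.sum_sum_type, tFractalGraph_degree_old, tFractalGraph_degree_mid,
      tFractalGraph_degree_leaf]
    rw [hG.sum_degree, ← hG.card_edgeSet]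
    simp
    ring
  have h3 : (tFractalGraph G m).edgeFinset.card = (m + 2) * Fintype.card G.edgeSet := by
    have h4 : (2 : ℝ) * ((tFractalGraph G m).edgeFinset.card : ℝ) =
        2 * ((m + 2) * (Fintype.card G.edgeSet : ℝ)) := by
      rw [← h2]
      exact_mod_cast h1.symm
    have h5 := mul_left_cancel₀ two_ne_zero h4
    exact_mod_cast h5
  rw [Nat.card_eq_fintype_card, Nat.card_eq_fintype_card, card_tFractalVertex, ← hG.card_edgeSet,
    ← SimpleGraph.edgeFinset_card, h3]
  ring

/-- The case of degree 1 in `sum_adj_dist`. -/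
theorem tFractalGraph_dist_leaf (hG : G.IsTree) (p : G.edgeSet × Fin m) {v : TFractalVertex G m}
    (hv : v ≠ .inr (.inr p)) :
    ((tFractalGraph G m).dist (.inr (.inr p)) v : ℝ) =
      (tFractalGraph G m).dist (.inr (.inl p.1)) v + 1 := by
  classical
  have h := (tFractalGraph_isTree (m := m) hG).sum_adj_dist hv.symm
  rw [tFractalGraph_degree_leaf] at h
  simp only [Fintype.sum_sum_type] at h
  simp at h
  linarith

-- In `sum_adj_dist` at the middle vertex, the m leaves contribute m(d + 1) out of (m + 2)(d + 1) -
-- 2, so the two old neighbours contribute 2d. Leaves attached to this vertex must be excluded as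
-- targets, since they are closer to themselves.
open Classical in
theorem tFractalGraph_dist_mid (hG : G.IsTree) (e : G.edgeSet) {v : TFractalVertex G m}
    (hv : v ≠ .inr (.inl e)) (hv' : ∀ i, v ≠ .inr (.inr (e, i))) :
    ((tFractalGraph G m).dist (.inr (.inl e)) v : ℝ) =
      (∑ a, if a ∈ (e : Sym2 V) then ((tFractalGraph G m).dist (.inl a) v : ℝ) else 0) / 2 := by
  have h := (tFractalGraph_isTree (m := m) hG).sum_adj_dist hv.symm
  rw [tFractalGraph_degree_mid] at h
  simp only [Fintype.sum_sum_type] at h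
  simp only [tFractalGraph_adj_mid_old, tFractalGraph_adj_mid_mid, tFractalGraph_adj_mid_leaf,
    if_false, Finset.sum_const_zero, zero_add, sum_leaves] at h
  rw [Finset.sum_congr rfl (fun i _ => tFractalGraph_dist_leaf hG (e, i) (hv' i))] at h
  simp only [Finset.sum_const, Finset.card_univ, Fintype.card_fin, nsmul_eq_mul] at h
  linarith

open Classical in
theorem tFractalGraph_dist_mid_old (hG : G.IsTree) (e : G.edgeSet) (y : V) :
    ((tFractalGraph G m).dist (.inr (.inl e)) (.inl y) : ℝ) =
      ∑ a, if a ∈ (e : Sym2 V) then (G.dist a y : ℝ) else 0 := by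
  rw [tFractalGraph_dist_mid hG e (by simp) (by simp), Finset.sum_div]
  refine Finset.sum_congr rfl fun a _ => ?_
  rw [tFractalGraph_dist_old_old hG.connected]
  split_ifs <;> push_cast <;> ring

-- For e = f both ends lie at distance 1, so the half-sum is 1 where the distance is 0; hence the
-- correction.
open Classical in
theorem tFractalGraph_dist_mid_mid (hG : G.IsTree) (e f : G.edgeSet) :
    ((tFractalGraph G m).dist (.inr (.inl e)) (.inr (.inl f)) : ℝ) =
      (∑ a, if a ∈ (e : Sym2 V) then
        ((tFractalGraph G m).dist (.inr (.inl f)) (.inl a) : ℝ) else 0) / 2 -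
      if e = f then 1 else 0 := by
  by_cases h : e = f
  · subst h
    have : ∀ a, (if a ∈ (e : Sym2 V) then
        ((tFractalGraph G m).dist (.inr (.inl e)) (.inl a) : ℝ) else 0) =
        if a ∈ (e : Sym2 V) then (1 : ℝ) else 0 := by
      intro a
      split_ifs with ha
      · rw [SimpleGraph.dist_eq_one_iff_adj.2 (by simpa using ha)]; simp
      · rfl
    simp only [this, sum_mem_edge_one]
    simp
  · rw [tFractalGraph_dist_mid hG e (by simpa using Ne.symm h) (by simp)]
    simp [h, SimpleGraph.dist_comm]

/-! The distance sums over the blocks of vertices. -/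

theorem sum_dist_mid_old (hG : G.IsTree) :
    ∑ e : G.edgeSet, ∑ y, ((tFractalGraph G m).dist (.inr (.inl e)) (.inl y) : ℝ) =
      4 * wienerIndex G - Fintype.card V * (Fintype.card V - 1) := by
  classical
  rw [Finset.sum_comm]
  simp only [tFractalGraph_dist_mid_old hG, sum_edge_sum_mem, hG.sum_degree_mul_dist]
  rw [Finset.sum_sub_distrib, ← Finset.mul_sum, Finset.sum_comm]
  simp [wienerIndex]
  ring

/-- Averaging over the ends of both edges yields a distance sum weighted by two degrees, so
`sum_degree_mul_dist` is used once for each weight. -/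
theorem sum_dist_mid_mid (hG : G.IsTree) :
    ∑ e : G.edgeSet, ∑ f : G.edgeSet,
      ((tFractalGraph G m).dist (.inr (.inl e)) (.inr (.inl f)) : ℝ) =
      4 * wienerIndex G - Fintype.card V * (Fintype.card V - 1) - (Fintype.card V - 1) ^ 2
        - (Fintype.card V - 1) := by
  classical
  have hE : (Fintype.card G.edgeSet : ℝ) = Fintype.card V - 1 := by
    rw [← hG.card_edgeSet]; push_cast; ring
  rw [Finset.sum_comm]
  simp only [tFractalGraph_dist_mid_mid hG _, Finset.sum_sub_distrib, ← Finset.sum_div,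
    sum_edge_sum_mem]
  rw [Finset.sum_comm]
  simp only [← Finset.mul_sum, tFractalGraph_dist_mid_old hG, sum_edge_sum_mem]
  have h1 : ∀ a, ∑ c, (G.degree c : ℝ) * G.dist c a =
      2 * ∑ c, (G.dist c a : ℝ) - ((Fintype.card V : ℝ) - 1) := hG.sum_degree_mul_dist
  simp only [h1, mul_sub, Finset.sum_sub_distrib, ← Finset.sum_mul, hG.sum_degree]
  have h2 : ∑ a, (G.degree a : ℝ) * (2 * ∑ c, (G.dist c a : ℝ)) =
      2 * (4 * wienerIndex G - Fintype.card V * (Fintype.card V - 1)) := by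
    simp only [Finset.mul_sum]
    rw [Finset.sum_comm]
    have : ∀ c, ∑ a, (G.degree a : ℝ) * (2 * (G.dist c a : ℝ)) =
        2 * (2 * ∑ a, (G.dist a c : ℝ) - ((Fintype.card V : ℝ) - 1)) := by
      intro c
      rw [← h1, Finset.mul_sum]
      exact Finset.sum_congr rfl fun a _ => by rw [SimpleGraph.dist_comm]; ring
    simp only [this, ← Finset.mul_sum, Finset.sum_sub_distrib]
    rw [Finset.sum_comm]
    simp [wienerIndex]
    ring
  rw [h2]
  simp only [Finset.sum_ite_eq', Finset.mem_univ, if_true, Finset.sum_const, Finset.card_univ,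
    nsmul_eq_mul, mul_one, hE]
  ring

theorem sum_dist_leaf_old (hG : G.IsTree) :
    ∑ p : G.edgeSet × Fin m, ∑ y, ((tFractalGraph G m).dist (.inr (.inr p)) (.inl y) : ℝ) =
      m * (∑ e : G.edgeSet, ∑ y, ((tFractalGraph G m).dist (.inr (.inl e)) (.inl y) : ℝ)
        + Fintype.card G.edgeSet * Fintype.card V) := by
  simp only [fun p y => tFractalGraph_dist_leaf (m := m) hG p (v := .inl y) (by simp)]
  rw [Fintype.sum_prod_type]
  simp only [Finset.sum_add_distrib, Finset.sum_const, Finset.card_univ, Fintype.card_fin,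
    nsmul_eq_mul, mul_one, ← Finset.mul_sum]
  ring

theorem sum_dist_leaf_mid (hG : G.IsTree) :
    ∑ p : G.edgeSet × Fin m, ∑ f : G.edgeSet,
      ((tFractalGraph G m).dist (.inr (.inr p)) (.inr (.inl f)) : ℝ) =
      m * (∑ e : G.edgeSet, ∑ f : G.edgeSet,
        ((tFractalGraph G m).dist (.inr (.inl e)) (.inr (.inl f)) : ℝ)
        + Fintype.card G.edgeSet ^ 2) := by
  simp only [fun p f => tFractalGraph_dist_leaf (m := m) hG p (v := .inr (.inl f)) (by simp)]
  rw [Fintype.sum_prod_type]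
  simp only [Finset.sum_add_distrib, Finset.sum_const, Finset.card_univ, Fintype.card_fin,
    nsmul_eq_mul, mul_one, ← Finset.mul_sum]
  ring

theorem sum_dist_leaf_leaf (hG : G.IsTree) :
    ∑ p : G.edgeSet × Fin m, ∑ q : G.edgeSet × Fin m,
      ((tFractalGraph G m).dist (.inr (.inr p)) (.inr (.inr q)) : ℝ) =
      m ^ 2 * (∑ e : G.edgeSet, ∑ f : G.edgeSet,
        ((tFractalGraph G m).dist (.inr (.inl e)) (.inr (.inl f)) : ℝ)
        + 2 * Fintype.card G.edgeSet ^ 2) - 2 * m * Fintype.card G.edgeSet := by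
  classical
  -- Distinct leaves on one middle vertex fit the same formula, with middle distance 0; only p = q
  -- needs the correction.
  have h : ∀ p q : G.edgeSet × Fin m,
      ((tFractalGraph G m).dist (.inr (.inr p)) (.inr (.inr q)) : ℝ) =
      (tFractalGraph G m).dist (.inr (.inl p.1)) (.inr (.inl q.1)) + 2
        - if p = q then 2 else 0 := by
    intro p q
    by_cases hpq : p = q
    · subst hpq; simp
    · rw [tFractalGraph_dist_leaf hG p (by simpa using Ne.symm hpq), SimpleGraph.dist_comm,
        tFractalGraph_dist_leaf hG q (by simp), SimpleGraph.dist_comm]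
      simp [hpq]; ring
  simp only [h, Finset.sum_sub_distrib, Finset.sum_add_distrib, Finset.sum_ite_eq, Finset.mem_univ,
    if_true]
  simp only [Fintype.sum_prod_type, Finset.sum_const, Finset.card_univ, Fintype.card_fin,
    nsmul_eq_mul, ← Finset.mul_sum, Fintype.card_prod]
  push_cast
  ring

theorem wienerIndex_tFractalGraph (hG : G.IsTree) :
    wienerIndex (tFractalGraph G m) =
      2 * ((m : ℝ) + 2) ^ 2 * wienerIndex G - ((m : ℝ) + 2) * (Fintype.card V : ℝ) ^ 2
        - ((m : ℝ) - 1) * ((m : ℝ) + 2) * Fintype.card V + ((m : ℝ) ^ 2 + 2 * m) := by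
  have hE : (Fintype.card G.edgeSet : ℝ) = Fintype.card V - 1 := by
    rw [← hG.card_edgeSet]; push_cast; ring
  have hA : ∑ x, ∑ y, ((tFractalGraph G m).dist (.inl x) (.inl y) : ℝ) = 4 * wienerIndex G := by
    simp only [tFractalGraph_dist_old_old hG.connected, wienerIndex]
    push_cast
    simp only [← Finset.mul_sum]
    ring
  have h1 := sum_dist_mid_old (m := m) hG
  have h2 := sum_dist_mid_mid (m := m) hG
  have h3 := sum_dist_leaf_old (m := m) hG
  have h4 := sum_dist_leaf_mid (m := m) hG
  have h5 := sum_dist_leaf_leaf (m := m) hG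
  have h1' : ∑ y, ∑ e : G.edgeSet, ((tFractalGraph G m).dist (.inl y) (.inr (.inl e)) : ℝ) =
      ∑ e : G.edgeSet, ∑ y, ((tFractalGraph G m).dist (.inr (.inl e)) (.inl y) : ℝ) := by
    rw [Finset.sum_comm]; simp only [SimpleGraph.dist_comm]
  have h3' : ∑ y, ∑ p : G.edgeSet × Fin m,
      ((tFractalGraph G m).dist (.inl y) (.inr (.inr p)) : ℝ) =
      ∑ p : G.edgeSet × Fin m, ∑ y, ((tFractalGraph G m).dist (.inr (.inr p)) (.inl y) : ℝ) := by
    rw [Finset.sum_comm]; simp only [SimpleGraph.dist_comm]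
  have h4' : ∑ e : G.edgeSet, ∑ p : G.edgeSet × Fin m,
      ((tFractalGraph G m).dist (.inr (.inl e)) (.inr (.inr p)) : ℝ) =
      ∑ p : G.edgeSet × Fin m, ∑ e : G.edgeSet,
        ((tFractalGraph G m).dist (.inr (.inr p)) (.inr (.inl e)) : ℝ) := by
    rw [Finset.sum_comm]; simp only [SimpleGraph.dist_comm]
  conv_lhs => unfold wienerIndex
  simp only [Fintype.sum_sum_type, Finset.sum_add_distrib]
  rw [h1', h3', h4', h5, h4, h3, h2, h1, hA, hE]
  ring

end TFractal

/-! ### Iteration of the operation. -/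

theorem order_tFractalStep (m : ℕ) (T : FiniteGraph.{u}) (hT : T.graph.IsTree) :
    (T.tFractalStep m).order = (T.order - 1) * (m + 2) + 1 := by
  classical
  have h1 : (T.tFractalStep m).order =
      Fintype.card T.Vertex + (m + 1) * Fintype.card T.graph.edgeSet := card_tFractalVertex
  have h2 : T.order = Fintype.card T.graph.edgeSet + 1 := hT.card_edgeSet.symm
  rw [h1, ← FiniteGraph.order, h2, Nat.add_sub_cancel]
  ring

theorem wienerIndex_tFractalStep (m : ℕ) (T : FiniteGraph.{u}) (hT : T.graph.IsTree) :
    wienerIndex (T.tFractalStep m).graph =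
      2 * ((m : ℝ) + 2) ^ 2 * wienerIndex T.graph - ((m : ℝ) + 2) * (T.order : ℝ) ^ 2
        - ((m : ℝ) - 1) * ((m : ℝ) + 2) * T.order + ((m : ℝ) ^ 2 + 2 * m) := by
  classical
  exact wienerIndex_tFractalGraph hT

theorem generalizedTFractal_isTree (m : ℕ) (T : FiniteGraph.{u}) (hT : T.graph.IsTree) (t : ℕ) :
    (generalizedTFractal m T t).graph.IsTree := by
  classical
  induction t with
  | zero => exact hT
  | succ t ih => exact tFractalGraph_isTree ih

theorem order_generalizedTFractal (m : ℕ) (T : FiniteGraph.{u}) (hT : T.graph.IsTree) (t : ℕ) :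
    (generalizedTFractal m T t).order = (T.order - 1) * (m + 2) ^ t + 1 := by
  induction t with
  | zero =>
    -- A tree is nonempty, so the truncated subtraction `T.order - 1` loses nothing.
    have : 0 < T.order := by
      have := hT.connected.nonempty
      exact Fintype.card_pos
    simp only [generalizedTFractal, pow_zero]
    omega
  | succ t ih =>
    rw [generalizedTFractal, order_tFractalStep m _ (generalizedTFractal_isTree m T hT t), ih,
      Nat.add_sub_cancel, pow_succ, mul_assoc]

theorem wienerIndex_generalizedTFractal (m : ℕ) (T : FiniteGraph.{u}) (hT : T.graph.IsTree)
    (t : ℕ) :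
    wienerIndex (generalizedTFractal m T t).graph =
      (2 * ((m : ℝ) + 2) ^ 2) ^ t * wienerIndex T.graph
        - ((m : ℝ) + 2) * ∑ i ∈ Finset.range t, (2 * ((m : ℝ) + 2) ^ 2) ^ i *
            ((generalizedTFractal m T (t - 1 - i)).order : ℝ) ^ 2
        - (((m : ℝ) - 1) * ((m : ℝ) + 2)) *
            ∑ i ∈ Finset.range t, (2 * ((m : ℝ) + 2) ^ 2) ^ i *
              ((generalizedTFractal m T (t - 1 - i)).order : ℝ)
        + ((m : ℝ) ^ 2 + 2 * (m : ℝ)) *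
            ∑ i ∈ Finset.range t, (2 * ((m : ℝ) + 2) ^ 2) ^ i := by
  induction t with
  | zero =>
    simp only [pow_zero, one_mul, Finset.range_zero, Finset.sum_empty, mul_zero, sub_zero, add_zero]
    rfl
  | succ t ih =>
    -- The term i = 0 carries the newest graph; the others are the previous sum multiplied once more
    -- by the growth factor. The constant sequence 1 covers the geometric sum.
    have hsum : ∀ a : ℕ → ℝ, ∑ i ∈ Finset.range (t + 1), (2 * ((m : ℝ) + 2) ^ 2) ^ i *
        a (t + 1 - 1 - i) = 2 * ((m : ℝ) + 2) ^ 2 * ∑ i ∈ Finset.range t,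
          (2 * ((m : ℝ) + 2) ^ 2) ^ i * a (t - 1 - i) + a t := by
      intro a
      rw [Finset.sum_range_succ', Finset.mul_sum]
      simp only [Nat.add_sub_cancel, pow_zero, one_mul, Nat.sub_zero]
      congr 1
      refine Finset.sum_congr rfl fun i _ => ?_
      rw [show t - (i + 1) = t - 1 - i by omega]
      ring
    have h1 := hsum fun s => ((generalizedTFractal m T s).order : ℝ) ^ 2
    have h2 := hsum fun s => ((generalizedTFractal m T s).order : ℝ)
    have h3 := hsum fun _ => 1
    simp only [mul_one] at h3
    rw [h1, h2, h3]
    have h4 := wienerIndex_tFractalStep m _ (generalizedTFractal_isTree m T hT t)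
    rw [ih] at h4
    refine h4.trans ?_
    ring

theorem propositionI13 (m t : ℕ) (T : FiniteGraph.{u}) (hT : T.graph.IsTree) :
    ((generalizedTFractal m T t).order = (T.order - 1) * (m + 2) ^ t + 1) ∧
    (2 ≤ T.order →
      meanHittingTime (generalizedTFractal m T t).graph ≠ ⊤ ∧
      (meanHittingTime (generalizedTFractal m T t).graph).toReal =
        (2 / ((generalizedTFractal m T t).order : ℝ)) *
          ((2 * ((m : ℝ) + 2) ^ 2) ^ t * wienerIndex T.graph
            - ((m : ℝ) + 2) * ∑ i ∈ Finset.range t, (2 * ((m : ℝ) + 2) ^ 2) ^ i *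
                ((generalizedTFractal m T (t - 1 - i)).order : ℝ) ^ 2
            - (((m : ℝ) - 1) * ((m : ℝ) + 2)) *
                ∑ i ∈ Finset.range t, (2 * ((m : ℝ) + 2) ^ 2) ^ i *
                  ((generalizedTFractal m T (t - 1 - i)).order : ℝ)
            + ((m : ℝ) ^ 2 + 2 * (m : ℝ)) *
                ∑ i ∈ Finset.range t, (2 * ((m : ℝ) + 2) ^ 2) ^ i)) := by
  have ho := order_generalizedTFractal m T hT t
  refine ⟨ho, fun hn => ?_⟩
  have hcard : 2 ≤ (generalizedTFractal m T t).order := by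
    rw [ho]
    have : 0 < (T.order - 1) * (m + 2) ^ t := Nat.mul_pos (by omega) (by positivity)
    omega
  rw [← wienerIndex_generalizedTFractal m T hT t]
  exact meanHittingTime_tree (generalizedTFractal_isTree m T hT t) hcard
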